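/- Graphs have finite node sets. Two DAGs are equivalent if they have the same skeleton and the same v-structures (pairs of edges $a\to b\leftarrow c$ with $a\neq c$ not adjacent); by Verma and Pearl this means that they imply the same independence constraints. For a partially directed graph $P$ (at most one edge, directed or undirected, between any two nodes), $[P]$ is the set of DAGs with the same skeleton and v-structures as $P$. A DAG property holds for $P$ if it holds for the DAGs in $[P]$. A CPDAG is such a graph $C$ with $[C]\neq\emptyset$ in which every directed edge is compelled (present in every DAG of $[C]$) and every undirected edge is reversible (not compelled). A clique is a set of pairwise adjacent nodes; the empty set is a clique. Let $C$ be a CPDAG. For adjacent $X,Y$, let $NA_{Y,X}$ be the set of nodes that are joined to $Y$ by an undirected edge and adjacent to $X$. $Delete(X,Y,H)$ is a GES delete operator for $C$ if (i) $C$ contains $X-Y$ or $X\to Y$, (ii) $H\subseteq NA_{Y,X}$, and (iii) $NA_{Y,X}\setminus H$ is a clique. Applying it removes the edge between $X$ and $Y$, replaces $Y-h$ by $Y\to h$, and $X-h$ (if present) by $X\to h$, for each $h\in H$, and then passes to the CPDAG $C'$ that represents the class of the resulting graph. For a DAG property $\Pi$, the operator is $\Pi$-consistent if $\Pi$ holds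 for the subgraph of $C'$ induced by $\{X,Y\}\cup W$, where $W$ is the set of common descendants (along directed paths) of $X$ and $Y$ in $C'$. Let $\Pi_{PS}^k$ be the property that every node has at most $k$ parents, $\Pi_{CL}^k$ the property that every clique has at most $k$ nodes, and $\Pi_{VW}^k$ the property that the v-width is at most $k$, i.e. for any two distinct non-adjacent nodes, every clique of common children of them has at most $k$ nodes. For $s\in\mathbb{N}$, Selective-Generate-Ops$(C,X,Y,s)$ computes the maximal cliques $C_1,\dots,C_m$ of the subgraph over $NA_{Y,X}$ (just $\emptyset$ if $NA_{Y,X}=\emptyset$); it discards those $C_i$ for which $NA_{Y,X}\setminus C_i$ contains a clique of size greater than $s$; and for each remaining $C_i$ and each $T\subseteq C_i$ with $|T|\le s$ it outputs $H=(NA_{Y,X}\setminus C_i)\cup T$. **Proposition.** Let $C$ be a CPDAG, $s\in\mathbb{N}$, and $\Pi\in\{\Pi_{PS}^{s+1},\Pi_{CL}^{s},\Pi_{VW}^{s}\}$. Then Selective-Generate-Ops with bound $s$, applied to all edges of $C$ (to $(X,Y)$ for each edge $X\to Y$, and to both $(X,Y)$ and $(Y,X)$ for each edge $X-Y$), generates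 every $\Pi$-consistent GES delete operator: if $Delete(X,Y,H)$ is a $\Pi$-consistent GES delete operator for $C$, then $C$ contains $X-Y$ or $X\to Y$, and $H$ is in the output of Selective-Generate-Ops$(C,X,Y,s)$. -/

import Mathlib

universe u

/-- A directed acyclic graph on the node set `V`; `edge a b` means `a → b`. -/
structure DAG (V : Type u) where
  edge : V → V → Prop
  acyclic : ∀ v, ¬ Relation.TransGen edge v v

/-- A graph with directed edges (`dir a b` means `a → b`) and undirected edges (`undir a b` means
`a - b`), with at most one edge between any two nodes and no loops. A PDAG is such a graph without
a directed cycle; the requirement is not made here, because it is automatic for every graph which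
has a DAG in its class (`PDGraph.dagClass`), and in particular for a CPDAG. -/
@[ext]
structure PDGraph (V : Type u) where
  dir : V → V → Prop
  undir : V → V → Prop
  dir_asymm : ∀ a b, dir a b → ¬ dir b a
  undir_symm : ∀ a b, undir a b → undir b a
  undir_irrefl : ∀ a, ¬ undir a a
  not_dir_and_undir : ∀ a b, dir a b → ¬ undir a b

namespace PDGraph

variable {V : Type u}

/-- The skeleton: the simple graph obtained by ignoring the directions of the edges. -/
def skeleton (P : PDGraph V) : SimpleGraph V where
  Adj a b := P.dir a b ∨ P.dir b a ∨ P.undir a b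
  symm := ⟨fun a b h => by
    rcases h with h | h | h
    · exact Or.inr (Or.inl h)
    · exact Or.inl h
    · exact Or.inr (Or.inr (P.undir_symm a b h))⟩
  loopless := ⟨fun a h => by
    rcases h with h | h | h
    · exact P.dir_asymm a a h h
    · exact P.dir_asymm a a h h
    · exact P.undir_irrefl a h⟩

/-- `a → b ← c` is a v-structure: `a ≠ c` and `a`, `c` are not adjacent. -/
def IsVStructure (P : PDGraph V) (a b c : V) : Prop :=
  P.dir a b ∧ P.dir c b ∧ a ≠ c ∧ ¬ P.skeleton.Adj a c

/-- The subgraph induced by a set of nodes. -/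
def induce (P : PDGraph V) (S : Set V) : PDGraph S where
  dir a b := P.dir a b
  undir a b := P.undir a b
  dir_asymm a b := P.dir_asymm a b
  undir_symm a b := P.undir_symm a b
  undir_irrefl a := P.undir_irrefl a
  not_dir_and_undir a b := P.not_dir_and_undir a b

/-- `b` is a descendant of `a`: `b = a` or there is a directed path from `a` to `b`. -/
def IsDescendant (P : PDGraph V) (a b : V) : Prop :=
  Relation.ReflTransGen P.dir a b

end PDGraph

/-- A DAG, as a partially directed graph without undirected edges. -/
def DAG.toPDGraph {V : Type u} (G : DAG V) : PDGraph V where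
  dir := G.edge
  undir _ _ := False
  dir_asymm a _ h h' := G.acyclic a (Relation.TransGen.tail (Relation.TransGen.single h) h')
  undir_symm _ _ h := h
  undir_irrefl _ h := h
  not_dir_and_undir _ _ _ h := h

/-- The equivalence class `[P]`: all DAGs which have the same skeleton and the same v-structures
as `P`. -/
def PDGraph.dagClass {V : Type u} (P : PDGraph V) : Set (DAG V) :=
  {G | G.toPDGraph.skeleton = P.skeleton ∧
    ∀ a b c, G.toPDGraph.IsVStructure a b c ↔ P.IsVStructure a b c}

/-- Two DAGs are equivalent if they have the same skeleton and the same v-structures. -/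
def DAG.Equivalent {V : Type u} (G G' : DAG V) : Prop :=
  G' ∈ G.toPDGraph.dagClass

/-- The edge `a → b` is present in `G` and in every DAG equivalent to `G`. -/
def DAG.IsCompelled {V : Type u} (G : DAG V) (a b : V) : Prop :=
  G.edge a b ∧ ∀ G' : DAG V, G.Equivalent G' → G'.edge a b

/-- The edge `a → b` is present in `G` and is not compelled. -/
def DAG.IsReversible {V : Type u} (G : DAG V) (a b : V) : Prop :=
  G.edge a b ∧ ¬ G.IsCompelled a b

/-- `C` is a CPDAG: it represents the class of some DAG `G`, its directed edges are compelled edges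
of `G`, and its undirected edges are reversible edges of `G`. -/
def PDGraph.IsCPDAG {V : Type u} (C : PDGraph V) : Prop :=
  ∃ G ∈ C.dagClass,
    (∀ a b, C.dir a b → G.IsCompelled a b) ∧
    (∀ a b, C.undir a b → G.IsReversible a b ∨ G.IsReversible b a)

/-! ### Properties of DAGs -/

/-- A property of DAGs over arbitrary finite node sets. -/
def DAGProperty : Type (u + 1) := ∀ (W : Type u) [Finite W], DAG W → Prop

/-- Every node has at most `k` parents. -/
def maxParentsProperty (k : ℕ) : DAGProperty.{u} := fun W _ G =>
  ∀ v : W, {a | G.edge a v}.ncard ≤ k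

/-- Every clique has at most `k` nodes. -/
def maxCliqueProperty (k : ℕ) : DAGProperty.{u} := fun W _ G =>
  ∀ K : Finset W, G.toPDGraph.skeleton.IsClique (K : Set W) → K.card ≤ k

/-- The v-width is at most `k`: for any two distinct non-adjacent nodes, every clique which
consists of common children of these nodes has at most `k` nodes. -/
def vWidthProperty (k : ℕ) : DAGProperty.{u} := fun W _ G =>
  ∀ a b : W, a ≠ b → ¬ G.toPDGraph.skeleton.Adj a b →
    ∀ K : Finset W, (∀ z ∈ K, G.edge a z ∧ G.edge b z) →
      G.toPDGraph.skeleton.IsClique (K : Set W) → K.card ≤ k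

/-- A property holds for a partially directed graph if it holds for the DAGs in its class. -/
def DAGProperty.HoldsFor (Pi : DAGProperty.{u}) {W : Type u} [Finite W] (P : PDGraph W) : Prop :=
  ∀ G ∈ P.dagClass, Pi W G

/-! ### Delete operators -/

namespace PDGraph

variable {V : Type u}

/-- The edge modifications of `Delete(X, Y, H)`, before the conversion to a CPDAG: the edge between
`X` and `Y` is removed, and for each `h ∈ H` an edge `Y - h` is replaced with `Y → h` and an edge
`X - h` with `X → h`. All other edges are kept. -/
def deleteTransform (C : PDGraph V) (X Y : V) (H : Finset V) : PDGraph V where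
  dir a b := ¬ (a = X ∧ b = Y) ∧ ¬ (a = Y ∧ b = X) ∧
    (C.dir a b ∨ ((a = Y ∨ a = X) ∧ b ∈ H ∧ C.undir a b))
  undir a b := ¬ (a = X ∧ b = Y) ∧ ¬ (a = Y ∧ b = X) ∧ C.undir a b ∧
    ¬ ((a = Y ∨ a = X) ∧ b ∈ H) ∧ ¬ ((b = Y ∨ b = X) ∧ a ∈ H)
  dir_asymm := by
    rintro a b ⟨h1, h2, h3⟩ ⟨-, -, h4⟩
    have e1 := C.dir_asymm a b
    have e2 := C.not_dir_and_undir a b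
    have e3 := C.not_dir_and_undir b a
    have e4 := C.undir_symm a b
    have e5 := C.undir_symm b a
    rcases h3 with h3 | ⟨ha, hb, hu⟩
    · rcases h4 with h4 | ⟨-, -, hu'⟩
      · exact e1 h3 h4
      · exact e2 h3 (e5 hu')
    · rcases h4 with h4 | ⟨hb', -, -⟩
      · exact e3 h4 (e4 hu)
      · rcases ha with rfl | rfl <;> rcases hb' with rfl | rfl
        · exact C.undir_irrefl _ hu
        · exact h2 ⟨rfl, rfl⟩
        · exact h1 ⟨rfl, rfl⟩
        · exact C.undir_irrefl _ hu
  undir_symm := by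
    rintro a b ⟨h1, h2, h3, h4, h5⟩
    exact ⟨fun h => h2 ⟨h.2, h.1⟩, fun h => h1 ⟨h.2, h.1⟩, C.undir_symm a b h3, h5, h4⟩
  undir_irrefl := by
    rintro a ⟨-, -, h, -, -⟩
    exact C.undir_irrefl a h
  not_dir_and_undir := by
    rintro a b ⟨-, -, h⟩ ⟨-, -, hu, hn, -⟩
    rcases h with h | ⟨h1, h2, -⟩
    · exact C.not_dir_and_undir a b h hu
    · exact hn ⟨h1, h2⟩

/-- `C'` is the CPDAG that results from applying `Delete(X, Y, H)` to `C`: the CPDAG which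
represents the class of the modified graph. -/
def IsDeleteResult (C : PDGraph V) (X Y : V) (H : Finset V) (C' : PDGraph V) : Prop :=
  C'.IsCPDAG ∧ C'.dagClass = (C.deleteTransform X Y H).dagClass

/-- `{X, Y} ∪ W`, where `W` is the set of common descendants of `X` and `Y`. -/
def commonDescendantNodes (P : PDGraph V) (X Y : V) : Set V :=
  {X, Y} ∪ {w | P.IsDescendant X w ∧ P.IsDescendant Y w}

variable [Fintype V]

open Classical in
/-- The neighbors of `Y` that are adjacent to `X`. -/
noncomputable def neighborsAdj (C : PDGraph V) (Y X : V) : Finset V :=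
  {h | C.undir Y h ∧ C.skeleton.Adj h X}

/-- The edge between `X` and `Y` is `X - Y` or `X → Y`. -/
def IsEdgeTo (C : PDGraph V) (X Y : V) : Prop :=
  C.undir X Y ∨ C.dir X Y

/-- `Delete(X, Y, H)` is a GES delete operator for `C`: its preconditions hold. -/
def IsDeleteOperator (C : PDGraph V) (X Y : V) (H : Finset V) : Prop :=
  C.IsEdgeTo X Y ∧ H ⊆ C.neighborsAdj Y X ∧
    C.skeleton.IsClique ((C.neighborsAdj Y X : Set V) \ (H : Set V))

/-- `Delete(X, Y, H)` is a `Π`-consistent GES delete operator for `C`. -/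
def IsConsistentDelete (C : PDGraph V) (Pi : DAGProperty.{u}) (X Y : V) (H : Finset V) : Prop :=
  C.IsDeleteOperator X Y H ∧
    ∃ C' : PDGraph V, C.IsDeleteResult X Y H C' ∧
      Pi.HoldsFor (C'.induce (C'.commonDescendantNodes X Y))

/-! ### The generation algorithm -/

open Classical in
/-- The maximal cliques among the nodes of `N` (if `N` is empty, the only one is `∅`). -/
noncomputable def maximalCliques (C : PDGraph V) (N : Finset V) : Finset (Finset V) :=
  {K | Maximal (fun K : Finset V => K ⊆ N ∧ C.skeleton.IsClique (K : Set V)) K}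

open Classical in
/-- Those members `K` of a family of sets of nodes of `N` for which no clique of size greater
than `s` remains after `K` is removed from the subgraph over `N`. -/
noncomputable def filterCliques (C : PDGraph V) (N : Finset V) (F : Finset (Finset V)) (s : ℕ) :
    Finset (Finset V) :=
  {K ∈ F | ∀ Q : Finset V, Q ⊆ N \ K → C.skeleton.IsClique (Q : Set V) → Q.card ≤ s}

open Classical in
/-- The output of Selective-Generate-Ops for the graph `C`, the nodes `X`, `Y` and the bound `s`:
the outer loop is over the filtered maximal cliques `K`, the inner loop is over the subsets `T` of
`K` of size at most `s`, and each step adds `(N \ K) ∪ T`. -/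
noncomputable def selectiveGenerateOps (C : PDGraph V) (X Y : V) (s : ℕ) : Finset (Finset V) :=
  let N := C.neighborsAdj Y X
  let S := C.filterCliques N (C.maximalCliques N) s
  S.biUnion fun K => {T ∈ K.powerset | T.card ≤ s}.image fun T => (N \ K) ∪ T

/-- The operators `Delete(X, Y, H)`, as triples `(X, Y, H)`, which are generated when
Selective-Generate-Ops is applied to all edges: to `(X, Y)` for each directed edge `X → Y`, and to
both `(X, Y)` and `(Y, X)` for each undirected edge `X - Y`. -/
def generatedOperators (C : PDGraph V) (s : ℕ) : Set (V × V × Finset V) :=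
  {op | C.IsEdgeTo op.1 op.2.1 ∧ op.2.2 ∈ C.selectiveGenerateOps op.1 op.2.1 s}

/-- The `Π`-consistent GES delete operators for `C`, as triples `(X, Y, H)`. -/
def consistentOperators (C : PDGraph V) (Pi : DAGProperty.{u}) : Set (V × V × Finset V) :=
  {op | C.IsConsistentDelete Pi op.1 op.2.1 op.2.2}

end PDGraph

/-!
Every node `h ∈ H` of a delete operator becomes a common child of `X` and `Y`, and `X`, `Y` are
not adjacent after the deletion, so `X → h ← Y` is a v-structure of the modified graph and hence
of `C'`. Thus `H` consists of common descendants of `X` and `Y`, and a DAG of `[C']`, restricted to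
`{X, Y} ∪ W`, is a DAG for which the property is known to hold. Each of the three properties then
bounds by `s` the cliques inside `H`; for the bound on parents, the last node of a clique `Q ⊆ H`
has as parents `X`, `Y` and the rest of `Q` (`PDGraph.card_le_of_isConsistentDelete`). Extending
the clique `N \ H`, with `N = NA_{Y,X}`, to a maximal clique `K` of `N`, one has `N \ K ⊆ H`, so
`K` survives the filter, and `T = H ∩ K` has at most `s` nodes and gives `H = (N \ K) ∪ T`.

The only graph-theoretic input is that `h → X` is impossible for `h ∈ NA_{Y,X}`. It rests on the
fact that in a CPDAG `a → b - c` implies `a → c` (`PDGraph.IsCPDAG.dir_of_dir_of_undir`). For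
this, the compelled edges of a DAG are identified with the edges generated from the v-structures by
three of Meek's orientation rules (`DAG.isCompelled_iff_meekOriented`). For generated edges the
implication is an induction over the rules (`DAG.MeekOriented.of_adj_of_not`). It implies that the
remaining edges can be reoriented along any perfect ordering without creating a directed cycle or
a v-structure, and a perfect ordering may begin with any given node
(`exists_perfectRank_clique_first`), so that none of these edges is compelled.
-/

/-! ### Perfect orderings -/

/-- The rank function `f` orders the nodes of `S` perfectly with respect to the graph `U`: adjacent
nodes have different ranks, and the neighbors of a node which precede it are pairwise adjacent.
Nodes which are not adjacent may have the same rank. -/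
def IsPerfectRank {V : Type*} (U : SimpleGraph V) (S : Finset V) (f : V → ℕ) : Prop :=
  (∀ x ∈ S, ∀ y ∈ S, U.Adj x y → f x ≠ f y) ∧
  ∀ z ∈ S, ∀ x ∈ S, ∀ y ∈ S, U.Adj x z → U.Adj y z → f x < f z → f y < f z → x ≠ y → U.Adj x y

/-- A graph with a perfect ordering has one in which a given clique comes first. If the last node
`a` is in the clique, its neighbors are put first by induction; since they and `a` form a clique,
they can be rearranged together with `a`. -/
theorem exists_perfectRank_clique_first {V : Type*} (U : SimpleGraph V) (f : V → ℕ)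
    (S : Finset V) (hf : IsPerfectRank U S f) (Q : Set V) (hQS : Q ⊆ S) (hQ : U.IsClique Q) :
    ∃ g, IsPerfectRank U S g ∧ ∀ q ∈ Q, ∀ x ∈ S, x ∉ Q → g q < g x := by
  classical
  induction S using Finset.induction_on_max_value f generalizing Q with
  | empty => exact ⟨f, hf, fun q hq => absurd (hQS hq) (by simp)⟩
  | insert a s has hmax ih =>
    have hfs : IsPerfectRank U s f :=
      ⟨fun x hx y hy => hf.1 x (Finset.mem_insert_of_mem hx) y (Finset.mem_insert_of_mem hy),
        fun z hz x hx y hy => hf.2 z (Finset.mem_insert_of_mem hz) x (Finset.mem_insert_of_mem hx)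
          y (Finset.mem_insert_of_mem hy)⟩
    by_cases haQ : a ∈ Q
    · have hlt : ∀ x ∈ s, U.Adj x a → f x < f a := fun x hx hxa =>
        lt_of_le_of_ne (hmax x hx) (hf.1 x (Finset.mem_insert_of_mem hx) a
          (Finset.mem_insert_self a s) hxa)
      have hN : U.IsClique {x | x ∈ s ∧ U.Adj x a} := fun x hx y hy hxy =>
        hf.2 a (Finset.mem_insert_self a s) x (Finset.mem_insert_of_mem hx.1) y
          (Finset.mem_insert_of_mem hy.1) hx.2 hy.2 (hlt x hx.1 hx.2) (hlt y hy.1 hy.2) hxy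
      obtain ⟨g, hg, hfirst⟩ := ih hfs _ (fun x hx => hx.1) hN
      obtain ⟨M, hM⟩ : ∃ M, ∀ x ∈ s, g x < M :=
        ⟨s.sup g + 1, fun x hx => Nat.lt_succ_of_le (Finset.le_sup hx)⟩
      have hQN : ∀ x ∈ s, x ∈ Q → U.Adj x a := fun x hx hxQ =>
        hQ hxQ haQ (fun h => has (h ▸ hx))
      let g' : V → ℕ := fun x => if x = a then 0 else if x ∈ Q then 1 + g x else 1 + M + g x
      have ha : g' a = 0 := by simp [g']
      have hin : ∀ x ∈ s, x ∈ Q → g' x = 1 + g x := fun x hx hxQ => by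
        have : x ≠ a := fun h => has (h ▸ hx)
        simp [g', this, hxQ]
      have hout : ∀ x ∈ s, x ∉ Q → g' x = 1 + M + g x := fun x hx hxQ => by
        have : x ≠ a := fun h => has (h ▸ hx)
        simp [g', this, hxQ]
      -- A node preceding a neighbor of `a` in the new ordering is itself a neighbor of `a`.
      have hpre : ∀ z ∈ s, U.Adj z a → ∀ x ∈ s, g' x < g' z → U.Adj x a := by
        intro z hz hza x hx hxz
        by_contra hxa
        have h1 := hfirst z ⟨hz, hza⟩ x hx (fun h => hxa h.2)
        have h2 := hout x hx (fun h => hxa (hQN x hx h))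
        by_cases hzQ : z ∈ Q
        · have := hin z hz hzQ; omega
        · have := hout z hz hzQ; omega
      -- Below a node which is not a neighbor of `a`, the two orderings agree.
      have hold : ∀ z ∈ s, ¬ U.Adj z a → ∀ x ∈ s, g' x < g' z → g x < g z := by
        intro z hz hza x hx hxz
        have h1 := hout z hz (fun h => hza (hQN z hz h))
        by_cases hxQ : x ∈ Q
        · exact hfirst x ⟨hx, hQN x hx hxQ⟩ z hz (fun h => hza h.2)
        · have := hout x hx hxQ; omega
      have hpos : ∀ x ∈ s, 0 < g' x := fun x hx => by
        by_cases hxQ : x ∈ Q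
        · have := hin x hx hxQ; omega
        · have := hout x hx hxQ; omega
      refine ⟨g', ⟨?_, ?_⟩, ?_⟩
      · intro x hx y hy hxy
        rw [Finset.mem_insert] at hx hy
        rcases hx with rfl | hx <;> rcases hy with rfl | hy
        · exact absurd hxy (U.irrefl)
        · have := hpos y hy; omega
        · have := hpos x hx; omega
        · have h1 := hg.1 x hx y hy hxy
          have h2 := hM x hx
          have h3 := hM y hy
          by_cases hxQ : x ∈ Q <;> by_cases hyQ : y ∈ Q
          · rw [hin x hx hxQ, hin y hy hyQ]; omega
          · rw [hin x hx hxQ, hout y hy hyQ]; omega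
          · rw [hout x hx hxQ, hin y hy hyQ]; omega
          · rw [hout x hx hxQ, hout y hy hyQ]; omega
      · intro z hz x hx y hy hxz hyz hx' hy' hxy
        rw [Finset.mem_insert] at hx hy hz
        rcases hz with rfl | hz
        · omega
        rcases hx with rfl | hx
        · rcases hy with rfl | hy
          · exact absurd rfl hxy
          · exact (hpre z hz hxz.symm y hy hy').symm
        rcases hy with rfl | hy
        · exact hpre z hz hyz.symm x hx hx'
        by_cases hza : U.Adj z a
        · exact hN ⟨hx, hpre z hz hza x hx hx'⟩ ⟨hy, hpre z hz hza y hy hy'⟩ hxy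
        · exact hg.2 z hz x hx y hy hxz hyz (hold z hz hza x hx hx') (hold z hz hza y hy hy') hxy
      · intro q hq x hx hxQ
        rw [Finset.mem_insert] at hx
        rcases hx with rfl | hx
        · exact absurd haQ hxQ
        have h1 := hout x hx hxQ
        rcases Finset.mem_insert.1 (hQS hq) with rfl | hq'
        · omega
        · have := hin q hq' hq
          have := hM q hq'
          omega
    · have hQs : Q ⊆ s := fun x hx => (Finset.mem_insert.1 (hQS hx)).resolve_left
        (fun h => haQ (h ▸ hx))
      obtain ⟨g, hg, hfirst⟩ := ih hfs Q hQs hQ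
      obtain ⟨M, hM⟩ : ∃ M, ∀ x ∈ s, g x < M :=
        ⟨s.sup g + 1, fun x hx => Nat.lt_succ_of_le (Finset.le_sup hx)⟩
      let g' : V → ℕ := fun x => if x = a then M else g x
      have ha : g' a = M := by simp [g']
      have hs : ∀ x ∈ s, g' x = g x := fun x hx => by
        have : x ≠ a := fun h => has (h ▸ hx)
        simp [g', this]
      have hlt : ∀ x ∈ s, U.Adj x a → f x < f a := fun x hx hxa =>
        lt_of_le_of_ne (hmax x hx) (hf.1 x (Finset.mem_insert_of_mem hx) a
          (Finset.mem_insert_self a s) hxa)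
      refine ⟨g', ⟨?_, ?_⟩, ?_⟩
      · intro x hx y hy hxy
        rw [Finset.mem_insert] at hx hy
        rcases hx with rfl | hx <;> rcases hy with rfl | hy
        · exact absurd hxy (U.irrefl)
        · rw [ha, hs y hy]; exact (hM y hy).ne'
        · rw [ha, hs x hx]; exact (hM x hx).ne
        · rw [hs x hx, hs y hy]; exact hg.1 x hx y hy hxy
      · intro z hz x hx y hy hxz hyz hx' hy' hxy
        rw [Finset.mem_insert] at hx hy hz
        rcases hz with rfl | hz
        · have hx := hx.resolve_left hxz.ne
          have hy := hy.resolve_left hyz.ne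
          exact hf.2 z (Finset.mem_insert_self z s) x (Finset.mem_insert_of_mem hx) y
            (Finset.mem_insert_of_mem hy) hxz hyz (hlt x hx hxz) (hlt y hy hyz) hxy
        · have hzM := hM z hz
          rw [hs z hz] at hx' hy'
          rcases hx with rfl | hx
          · omega
          rcases hy with rfl | hy
          · omega
          rw [hs x hx] at hx'
          rw [hs y hy] at hy'
          exact hg.2 z hz x hx y hy hxz hyz hx' hy' hxy
      · intro q hq x hx hxQ
        rw [Finset.mem_insert] at hx
        rw [hs q (hQs hq)]
        rcases hx with rfl | hx
        · rw [ha]; exact hM q (hQs hq)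
        · rw [hs x hx]; exact hfirst q hq x hx hxQ

/-! ### Meek's orientation rules -/

namespace DAG

variable {V : Type u} {G : DAG V}

theorem skeleton_adj {a b : V} :
    G.toPDGraph.skeleton.Adj a b ↔ G.edge a b ∨ G.edge b a := by
  simp [PDGraph.skeleton, toPDGraph]

theorem not_edge_symm {a b : V} (h : G.edge a b) : ¬ G.edge b a := fun h' =>
  G.acyclic a ((Relation.TransGen.single h).tail h')

theorem not_edge_self {a : V} : ¬ G.edge a a := fun h => not_edge_symm h h

theorem edge_trans_of_adj {a b c : V} (hab : G.edge a b) (hbc : G.edge b c)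
    (hac : G.toPDGraph.skeleton.Adj a c) : G.edge a c :=
  (skeleton_adj.1 hac).resolve_right fun h =>
    G.acyclic a (((Relation.TransGen.single hab).tail hbc).tail h)

/-- The edges of `G` which are generated from its v-structures by Meek's first three orientation
rules. The premise that the conclusion is an edge of `G` and, in the third rule, the premise that
`b → a ← c` is not a v-structure, replace the requirement that the edges concerned are not yet
oriented. -/
inductive MeekOriented (G : DAG V) : V → V → Prop
  | vstructure {a b c : V} : G.toPDGraph.IsVStructure a b c → MeekOriented G a b
  | rule_one {a b c : V} : MeekOriented G a b → G.edge b c →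
      ¬ G.toPDGraph.skeleton.Adj a c → MeekOriented G b c
  | rule_two {a b c : V} : MeekOriented G a b → MeekOriented G b c → G.edge a c →
      MeekOriented G a c
  | rule_three {a b c d : V} : MeekOriented G b d → MeekOriented G c d → b ≠ c →
      ¬ G.toPDGraph.skeleton.Adj b c → G.toPDGraph.skeleton.Adj a b →
      G.toPDGraph.skeleton.Adj a c → ¬ G.toPDGraph.IsVStructure b a c → G.edge a d →
      MeekOriented G a d

theorem MeekOriented.edge {a b : V} (h : G.MeekOriented a b) : G.edge a b := by
  cases h with
  | vstructure h => exact h.1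
  | rule_one _ h _ => exact h
  | rule_two _ _ h => exact h
  | rule_three _ _ _ _ _ _ _ h => exact h

theorem MeekOriented.edge_of_equivalent {a b : V} (h : G.MeekOriented a b) {G' : DAG V}
    (hG' : G.Equivalent G') : G'.edge a b := by
  obtain ⟨hsk, hvs⟩ := hG'
  have hor : ∀ {x y : V}, G.toPDGraph.skeleton.Adj x y → G'.edge x y ∨ G'.edge y x := fun h => by
    rw [← hsk] at h; exact skeleton_adj.1 h
  induction h with
  | vstructure h => exact ((hvs _ _ _).2 h).1
  | @rule_one a b c hab hbc hac ih =>
    refine (hor (skeleton_adj.2 (Or.inl hbc))).resolve_right fun hcb => ?_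
    have hne : a ≠ c := by rintro rfl; exact not_edge_symm hab.edge hbc
    exact not_edge_symm hbc ((hvs a b c).1 ⟨ih, hcb, hne, by rwa [hsk]⟩).2.1
  | rule_two hab hbc hac ih₁ ih₂ =>
    exact edge_trans_of_adj ih₁ ih₂ (by rw [hsk]; exact skeleton_adj.2 (Or.inl hac))
  | @rule_three a b c d hbd hcd hne hbc hab hac hnv had ih₁ ih₂ =>
    refine (hor (skeleton_adj.2 (Or.inl had))).resolve_right fun hda => hnv ?_
    refine (hvs b a c).1 ⟨edge_trans_of_adj ih₁ hda ?_, edge_trans_of_adj ih₂ hda ?_, hne, ?_⟩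
    · rw [hsk]; exact hab.symm
    · rw [hsk]; exact hac.symm
    · rwa [hsk]

/-- By the first rule and the v-structures, an edge `a → b` which is oriented by Meek's rules and an
edge `b - c` which is not span a triangle. -/
theorem MeekOriented.adj_of_adj_of_not {a b c : V} (h : G.MeekOriented a b)
    (hbc : G.toPDGraph.skeleton.Adj b c) (h₁ : ¬ G.MeekOriented b c) (h₂ : ¬ G.MeekOriented c b) :
    G.toPDGraph.skeleton.Adj a c := by
  by_contra hac
  rcases skeleton_adj.1 hbc with hbc | hcb
  · exact h₁ (h.rule_one hbc hac)
  · refine h₂ (.vstructure (c := a) ⟨hcb, h.edge, ?_, fun h' => hac h'.symm⟩)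
    rintro rfl
    exact h₂ h

/-- If `a → b` is oriented by Meek's rules and `b - c` is not, then `a → c` is oriented. -/
theorem MeekOriented.of_adj_of_not {a b c : V} (h : G.MeekOriented a b)
    (hbc : G.toPDGraph.skeleton.Adj b c) (h₁ : ¬ G.MeekOriented b c) (h₂ : ¬ G.MeekOriented c b) :
    G.MeekOriented a c := by
  induction h generalizing c with
  | @vstructure a b d h =>
    obtain ⟨hab, hdb, hne, had⟩ := id h
    have kab : G.MeekOriented a b := .vstructure h
    have kdb : G.MeekOriented d b :=
      .vstructure (c := a) ⟨hdb, hab, hne.symm, fun h => had h.symm⟩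
    -- Both tails of `a → b ← d` are adjacent to `c`, so the third rule would orient `c → b`.
    have hac := kab.adj_of_adj_of_not hbc h₁ h₂
    have hdc := kdb.adj_of_adj_of_not hbc h₁ h₂
    by_contra kac
    have hncv : ¬ G.toPDGraph.IsVStructure a c d := fun h => kac (.vstructure h)
    have hcb : G.edge c b := by
      refine (skeleton_adj.1 hbc).resolve_left fun hbc' => ?_
      exact hncv ⟨edge_trans_of_adj hab hbc' hac, edge_trans_of_adj hdb hbc' hdc, hne, had⟩
    exact h₂ (.rule_three kab kdb hne had hac.symm hdc.symm hncv hcb)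
  | @rule_one d a b kda hab hdb ih =>
    have kab := kda.rule_one hab hdb
    by_contra kac
    have hac := kab.adj_of_adj_of_not hbc h₁ h₂
    -- The second rule excludes `c → a → b`.
    have kca : ¬ G.MeekOriented c a := fun kca =>
      h₂ (kca.rule_two kab (edge_trans_of_adj kca.edge hab hbc.symm))
    have kdc : G.MeekOriented d c := ih hac kac kca
    -- Since `d` and `b` are not adjacent, `d → c` orients `b - c` one way or the other.
    rcases skeleton_adj.1 hbc with hbc | hcb
    · refine h₁ (.vstructure (c := d) ⟨hbc, kdc.edge, ?_, fun h => hdb h.symm⟩)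
      rintro rfl
      exact not_edge_symm kda.edge hab
    · exact h₂ (kdc.rule_one hcb hdb)
  | @rule_two a d b kad kdb hab ih₁ ih₂ =>
    have kdc := ih₂ hbc h₁ h₂
    exact kad.rule_two kdc
      (edge_trans_of_adj kad.edge kdc.edge
        ((kad.rule_two kdb hab).adj_of_adj_of_not hbc h₁ h₂))
  | @rule_three a d e b kdb keb hne hde had hae hnv hab ih₁ ih₂ =>
    have kdc := ih₁ hbc h₁ h₂
    have kec := ih₂ hbc h₁ h₂
    have kab : G.MeekOriented a b := .rule_three kdb keb hne hde had hae hnv hab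
    have hac := kab.adj_of_adj_of_not hbc h₁ h₂
    refine .rule_three kdc kec hne hde had hae hnv ((skeleton_adj.1 hac).resolve_right fun hca => ?_)
    exact hnv ⟨edge_trans_of_adj kdc.edge hca had.symm, edge_trans_of_adj kec.edge hca hae.symm,
      hne, hde⟩

/-! ### Compelled edges -/

/-- The edges of the skeleton which are not oriented by Meek's rules. -/
def unoriented (G : DAG V) : SimpleGraph V where
  Adj a b := G.toPDGraph.skeleton.Adj a b ∧ ¬ G.MeekOriented a b ∧ ¬ G.MeekOriented b a
  symm := ⟨fun _ _ h => ⟨h.1.symm, h.2.2, h.2.1⟩⟩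
  loopless := ⟨fun _ h => h.1.ne rfl⟩

theorem MeekOriented.of_unoriented {a b c : V} (h : G.MeekOriented a b)
    (hbc : G.unoriented.Adj b c) : G.MeekOriented a c :=
  h.of_adj_of_not hbc.1 hbc.2.1 hbc.2.2

theorem exists_rank [Finite V] (G : DAG V) : ∃ f : V → ℕ, ∀ a b, G.edge a b → f a < f b := by
  refine ⟨fun v => {a | Relation.TransGen G.edge a v}.ncard, fun a b hab => ?_⟩
  refine Set.ncard_lt_ncard ⟨fun x hx => Relation.TransGen.tail hx hab, fun h => ?_⟩
    (Set.toFinite _)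
  exact G.acyclic a (h (Relation.TransGen.single hab))

theorem exists_perfectRank [Fintype V] (G : DAG V) :
    ∃ f, IsPerfectRank G.unoriented Finset.univ f := by
  obtain ⟨f, hf⟩ := G.exists_rank
  have hedge : ∀ {x y}, G.unoriented.Adj x y → f x < f y → G.edge x y := fun {x y} h hlt =>
    (skeleton_adj.1 h.1).resolve_right fun h' => absurd (hf y x h') (by omega)
  refine ⟨f, fun x _ y _ h => ?_, fun z _ x _ y _ hxz hyz hx hy hxy => ⟨?_, ?_, ?_⟩⟩
  · rcases skeleton_adj.1 h.1 with h | h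
    · exact (hf _ _ h).ne
    · exact (hf _ _ h).ne'
  -- Two tails of unoriented edges into `z` are adjacent, since their edges form no v-structure.
  · by_contra h
    exact hxz.2.1 (.vstructure ⟨hedge hxz hx, hedge hyz hy, hxy, h⟩)
  · exact fun h => hxz.2.1 (h.of_unoriented hyz)
  · exact fun h => hyz.2.1 (h.of_unoriented hxz)

/-- The edges oriented by Meek's rules, and the other edges directed towards the higher rank. -/
def reorientedEdge (G : DAG V) (f : V → ℕ) (a b : V) : Prop :=
  G.MeekOriented a b ∨ (G.unoriented.Adj a b ∧ f a < f b)

theorem transGen_meekOriented_of_reflTransGen_unoriented {a b c : V}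
    (h : Relation.TransGen G.MeekOriented a b)
    (hbc : Relation.ReflTransGen G.unoriented.Adj b c) : Relation.TransGen G.MeekOriented a c := by
  induction hbc with
  | refl => exact h
  | tail _ hcd ih =>
    cases ih with
    | single h => exact .single (h.of_unoriented hcd)
    | tail h h' => exact h.tail (h'.of_unoriented hcd)

/-- On a directed path, the undirected edges after a Meek-oriented edge can be absorbed into it, so
a directed cycle would yield a cycle of Meek-oriented edges or one of increasing ranks. -/
theorem reorientedEdge_acyclic (G : DAG V) (f : V → ℕ) (v : V) :
    ¬ Relation.TransGen (G.reorientedEdge f) v v := by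
  have key : ∀ w, Relation.TransGen (G.reorientedEdge f) v w →
      (f v < f w ∧ Relation.ReflTransGen G.unoriented.Adj v w) ∨
      ∃ u, Relation.ReflTransGen G.unoriented.Adj v u ∧ Relation.TransGen G.MeekOriented u w := by
    intro w h
    induction h with
    | single h =>
      rcases h with h | ⟨h, hlt⟩
      · exact Or.inr ⟨v, .refl, .single h⟩
      · exact Or.inl ⟨hlt, .single h⟩
    | tail _ h ih =>
      rcases ih with ⟨hlt', hr⟩ | ⟨u, hu, ht⟩ <;> rcases h with h | ⟨h, hlt⟩
      · exact Or.inr ⟨_, hr, .single h⟩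
      · exact Or.inl ⟨hlt'.trans hlt, hr.tail h⟩
      · exact Or.inr ⟨u, hu, ht.tail h⟩
      · exact Or.inr ⟨u, hu, transGen_meekOriented_of_reflTransGen_unoriented ht (.single h)⟩
  intro h
  rcases key v h with ⟨hlt, -⟩ | ⟨u, hu, ht⟩
  · exact lt_irrefl _ hlt
  · exact G.acyclic u (Relation.TransGen.mono (fun _ _ => MeekOriented.edge) u u
      (transGen_meekOriented_of_reflTransGen_unoriented ht hu))

/-- The DAG with the edges `G.reorientedEdge f`. -/
def reorient (G : DAG V) (f : V → ℕ) : DAG V where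
  edge := G.reorientedEdge f
  acyclic := G.reorientedEdge_acyclic f

theorem equivalent_reorient [Fintype V] {f : V → ℕ}
    (hf : IsPerfectRank G.unoriented Finset.univ f) : G.Equivalent (G.reorient f) := by
  have hadj : ∀ a b, (G.reorient f).toPDGraph.skeleton.Adj a b ↔
      G.toPDGraph.skeleton.Adj a b := by
    intro a b
    rw [skeleton_adj (G := G.reorient f)]
    constructor
    · rintro ((h | h) | (h | h))
      · exact skeleton_adj.2 (Or.inl h.edge)
      · exact h.1.1
      · exact skeleton_adj.2 (Or.inr h.edge)
      · exact h.1.1.symm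
    · intro h
      by_cases h₁ : G.MeekOriented a b
      · exact Or.inl (Or.inl h₁)
      by_cases h₂ : G.MeekOriented b a
      · exact Or.inr (Or.inl h₂)
      have hu : G.unoriented.Adj a b := ⟨h, h₁, h₂⟩
      rcases lt_or_gt_of_ne (hf.1 a (Finset.mem_univ a) b (Finset.mem_univ b) hu) with hlt | hlt
      · exact Or.inl (Or.inr ⟨hu, hlt⟩)
      · exact Or.inr (Or.inr ⟨hu.symm, hlt⟩)
  refine ⟨by ext a b; exact hadj a b, fun a b c => ⟨?_, ?_⟩⟩
  · rintro ⟨hab, hcb, hne, hac⟩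
    rw [hadj] at hac
    rcases hab with hab | ⟨hab, hab'⟩ <;> rcases hcb with hcb | ⟨hcb, hcb'⟩
    · exact ⟨hab.edge, hcb.edge, hne, hac⟩
    · exact absurd (skeleton_adj.2 (Or.inl (hab.of_unoriented hcb.symm).edge)) hac
    · exact absurd (skeleton_adj.2 (Or.inr (hcb.of_unoriented hab.symm).edge)) hac
    · exact absurd (hf.2 b (Finset.mem_univ b) a (Finset.mem_univ a) c (Finset.mem_univ c)
        hab hcb hab' hcb' hne).1 hac
  · intro h
    have h' : G.toPDGraph.IsVStructure c b a :=
      ⟨h.2.1, h.1, h.2.2.1.symm, fun h₀ => h.2.2.2 h₀.symm⟩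
    exact ⟨Or.inl (.vstructure h), Or.inl (.vstructure h'), h.2.2.1, fun h₀ =>
      h.2.2.2 ((hadj a c).1 h₀)⟩

/-- Meek's rules are sound and complete for the compelled edges of a DAG. -/
theorem isCompelled_iff_meekOriented [Fintype V] {a b : V} :
    G.IsCompelled a b ↔ G.MeekOriented a b := by
  refine ⟨fun h => ?_, fun h => ⟨h.edge, fun G' hG' => h.edge_of_equivalent hG'⟩⟩
  by_contra hab
  have hba : ¬ G.MeekOriented b a := fun h' => not_edge_symm h.1 h'.edge
  have hu : G.unoriented.Adj a b := ⟨skeleton_adj.2 (Or.inl h.1), hab, hba⟩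
  obtain ⟨f, hf⟩ := G.exists_perfectRank
  -- A perfect ordering that begins with `b` reverses the edge `a → b`.
  obtain ⟨g, hg, hfirst⟩ := exists_perfectRank_clique_first G.unoriented f Finset.univ hf {b}
    (by simp) (by simp)
  have hlt : g b < g a := hfirst b rfl a (Finset.mem_univ a) hu.ne
  rcases h.2 _ (equivalent_reorient hg) with h' | h'
  · exact hab h'
  · exact lt_asymm hlt h'.2

end DAG

/-! ### CPDAGs -/

namespace PDGraph

variable {V : Type u} {C : PDGraph V}

theorem IsCPDAG.exists_meekOriented [Fintype V] (hC : C.IsCPDAG) :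
    ∃ G : DAG V, (∀ a b, C.dir a b ↔ G.MeekOriented a b) ∧
      ∀ a b, C.undir a b ↔ G.unoriented.Adj a b := by
  obtain ⟨G, ⟨hsk, -⟩, hdir, hundir⟩ := hC
  have hd : ∀ a b, C.dir a b → G.MeekOriented a b := fun a b h =>
    DAG.isCompelled_iff_meekOriented.1 (hdir a b h)
  have hr : ∀ {a b}, G.IsReversible a b → G.unoriented.Adj a b := fun {a b} h =>
    ⟨DAG.skeleton_adj.2 (Or.inl h.1), fun h' => h.2 (DAG.isCompelled_iff_meekOriented.2 h'),
      fun h' => DAG.not_edge_symm h.1 h'.edge⟩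
  have hu : ∀ a b, C.undir a b → G.unoriented.Adj a b := fun a b h =>
    (hundir a b h).elim hr fun h' => (hr h').symm
  have hadj : ∀ {a b}, G.toPDGraph.skeleton.Adj a b → C.dir a b ∨ C.dir b a ∨ C.undir a b := by
    intro a b h
    rw [hsk] at h
    exact h
  refine ⟨G, fun a b => ⟨hd a b, fun h => ?_⟩, fun a b => ⟨hu a b, fun h => ?_⟩⟩
  · rcases hadj (DAG.skeleton_adj.2 (Or.inl h.edge)) with h' | h' | h'
    · exact h'
    · exact absurd (hd _ _ h').edge (DAG.not_edge_symm h.edge)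
    · exact absurd h (hu _ _ h').2.1
  · rcases hadj h.1 with h' | h' | h'
    · exact absurd (hd _ _ h') h.2.1
    · exact absurd (hd _ _ h') h.2.2
    · exact h'

theorem IsCPDAG.dir_of_dir_of_undir [Fintype V] (hC : C.IsCPDAG) {a b c : V} (hab : C.dir a b)
    (hbc : C.undir b c) : C.dir a c := by
  obtain ⟨G, hdir, hundir⟩ := hC.exists_meekOriented
  exact (hdir a c).2 (((hdir a b).1 hab).of_unoriented ((hundir b c).1 hbc))

theorem IsCPDAG.not_undir_of_dir_of_dir [Fintype V] (hC : C.IsCPDAG) {a b c : V} (hab : C.dir a b)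
    (hbc : C.dir b c) : ¬ C.undir a c := by
  obtain ⟨G, hdir, hundir⟩ := hC.exists_meekOriented
  rw [hdir] at hab hbc
  intro hac
  rw [hundir] at hac
  exact hac.2.1 (hab.rule_two hbc (DAG.edge_trans_of_adj hab.edge hbc.edge hac.1))

/-- A neighbor of `Y` that is adjacent to `X` cannot be a parent of `X`. -/
theorem IsCPDAG.isEdgeTo_of_mem_neighborsAdj [Fintype V] (hC : C.IsCPDAG) {X Y h : V}
    (hXY : C.IsEdgeTo X Y) (hh : h ∈ C.neighborsAdj Y X) : C.IsEdgeTo X h := by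
  simp only [neighborsAdj, Finset.mem_filter, Finset.mem_univ, true_and] at hh
  obtain ⟨hYh, hhX | hXh | hu⟩ := hh
  · rcases hXY with hXY | hXY
    · exact absurd hYh fun h' =>
        C.not_dir_and_undir _ _ (hC.dir_of_dir_of_undir hhX hXY) (C.undir_symm _ _ h')
    · exact absurd (C.undir_symm _ _ hYh) (hC.not_undir_of_dir_of_dir hhX hXY)
  · exact Or.inr hXh
  · exact Or.inl (C.undir_symm _ _ hu)

/-! ### Delete operators -/

theorem not_deleteTransform_adj {X Y : V} {H : Finset V} :
    ¬ (C.deleteTransform X Y H).skeleton.Adj X Y := by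
  simp [skeleton, deleteTransform]

theorem deleteTransform_adj_of_ne {X Y a b : V} {H : Finset V} (h : C.skeleton.Adj a b)
    (h₁ : ¬ (a = X ∧ b = Y)) (h₂ : ¬ (a = Y ∧ b = X)) :
    (C.deleteTransform X Y H).skeleton.Adj a b := by
  have := C.undir_symm a b
  simp only [skeleton, deleteTransform] at h ⊢
  tauto

theorem IsEdgeTo.ne {X Y : V} (h : C.IsEdgeTo X Y) : X ≠ Y := by
  rintro rfl
  rcases h with h | h
  · exact C.undir_irrefl _ h
  · exact C.dir_asymm _ _ h h

/-- The nodes of `H` become common children of the two nodes which are no longer adjacent. -/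
theorem isVStructure_deleteTransform [Fintype V] (hC : C.IsCPDAG) {X Y : V} {H : Finset V}
    (hop : C.IsDeleteOperator X Y H) {h : V} (hh : h ∈ H) :
    (C.deleteTransform X Y H).IsVStructure X h Y := by
  obtain ⟨hXY, hH, -⟩ := hop
  have hXh := hC.isEdgeTo_of_mem_neighborsAdj hXY (hH hh)
  have hYh : C.undir Y h := by
    have := hH hh
    simp only [neighborsAdj, Finset.mem_filter] at this
    exact this.2.1
  have hne₁ : h ≠ Y := fun e => C.undir_irrefl _ (e ▸ hYh)
  have hne₂ : h ≠ X := hXh.ne.symm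
  refine ⟨⟨fun e => hne₁ e.2, fun e => hne₂ e.2, ?_⟩, ⟨fun e => hne₁ e.2, fun e => hne₂ e.2, ?_⟩,
    hXY.ne, not_deleteTransform_adj⟩
  · rcases hXh with hXh | hXh
    · exact Or.inr ⟨Or.inr rfl, hh, hXh⟩
    · exact Or.inl hXh
  · exact Or.inr ⟨Or.inl rfl, hh, hYh⟩

end PDGraph

/-- The subgraph of a DAG induced by a set of nodes. -/
def DAG.induce {V : Type u} (G : DAG V) (S : Set V) : DAG S where
  edge a b := G.edge a b
  acyclic v h := G.acyclic v (Relation.TransGen.lift Subtype.val (fun _ _ h => h) v v h)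

theorem DAG.induce_mem_dagClass {V : Type u} {G : DAG V} {P : PDGraph V} (hG : G ∈ P.dagClass)
    (S : Set V) : G.induce S ∈ (P.induce S).dagClass := by
  obtain ⟨hsk, hvs⟩ := hG
  have hadj : ∀ a b : S, (G.induce S).toPDGraph.skeleton.Adj a b ↔
      (P.induce S).skeleton.Adj a b := fun a b =>
    Iff.of_eq (congrArg (fun K : SimpleGraph V => K.Adj a b) hsk)
  refine ⟨by ext a b; exact hadj a b, fun a b c => ?_⟩
  have key := hvs a b c
  simp only [PDGraph.IsVStructure] at key ⊢
  rw [hadj]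
  rw [hsk] at key
  rw [ne_eq, Subtype.ext_iff]
  exact key

/-- In a DAG with at most `s + 1` parents for each node, a clique of common children of two nodes
has at most `s` nodes: the last node of the clique has the two nodes and the rest of the clique as
parents. -/
theorem DAG.card_le_of_maxParents {V : Type u} [Finite V] {G : DAG V} {s : ℕ}
    (hG : maxParentsProperty (s + 1) V G) {a b : V} (hab : a ≠ b) {Q : Finset V}
    (hQ : ∀ z ∈ Q, G.edge a z ∧ G.edge b z) (hcl : G.toPDGraph.skeleton.IsClique (Q : Set V)) :
    Q.card ≤ s := by
  classical
  rcases Q.eq_empty_or_nonempty with rfl | hne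
  · simp
  obtain ⟨f, hf⟩ := G.exists_rank
  obtain ⟨z, hz, hmax⟩ := Q.exists_max_image f hne
  have hsub : ((insert a (insert b (Q.erase z)) : Finset V) : Set V) ⊆ {p | G.edge p z} := by
    intro p hp
    simp only [Finset.coe_insert, Set.mem_insert_iff, Finset.mem_coe, Finset.mem_erase] at hp
    rcases hp with rfl | rfl | ⟨hpz, hp⟩
    · exact (hQ z hz).1
    · exact (hQ z hz).2
    · refine (DAG.skeleton_adj.1 (hcl hp hz hpz)).resolve_right fun h => ?_
      exact absurd (hf z p h) (not_lt.2 (hmax p hp))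
  have hle := (Set.ncard_le_ncard hsub (Set.toFinite _)).trans (hG z)
  have ha : a ∉ insert b (Q.erase z) := by
    simp only [Finset.mem_insert, Finset.mem_erase, not_or, not_and]
    exact ⟨hab, fun _ h => DAG.not_edge_self (hQ a h).1⟩
  have hb : b ∉ Q.erase z := fun h =>
    DAG.not_edge_self (hQ b (Finset.mem_of_mem_erase h)).2
  rw [Set.ncard_coe_finset, Finset.card_insert_of_notMem ha, Finset.card_insert_of_notMem hb,
    Finset.card_erase_of_mem hz] at hle
  omega

namespace PDGraph

variable {V : Type u} [Fintype V] {C : PDGraph V}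

/-- Each of the three properties bounds the cliques in the set `H` of a consistent operator. -/
theorem card_le_of_isConsistentDelete (hC : C.IsCPDAG) {s : ℕ} {Pi : DAGProperty.{u}}
    (hPi : Pi = maxParentsProperty (s + 1) ∨ Pi = maxCliqueProperty s ∨ Pi = vWidthProperty s)
    {X Y : V} {H : Finset V} (hop : C.IsConsistentDelete Pi X Y H) {Q : Finset V} (hQH : Q ⊆ H)
    (hQ : C.skeleton.IsClique (Q : Set V)) : Q.card ≤ s := by
  classical
  obtain ⟨hdel, C', ⟨⟨G, hG, -⟩, hcls⟩, hhold⟩ := hop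
  have hG' : G ∈ (C.deleteTransform X Y H).dagClass := hcls ▸ hG
  have hGv : ∀ h ∈ H, G.toPDGraph.IsVStructure X h Y := fun h hh =>
    (hG'.2 X h Y).2 (isVStructure_deleteTransform hC hdel hh)
  have hC'v : ∀ h ∈ H, C'.IsVStructure X h Y := fun h hh => (hG.2 X h Y).1 (hGv h hh)
  set S := C'.commonDescendantNodes X Y with hS
  have hXS : X ∈ S := Or.inl (Or.inl rfl)
  have hYS : Y ∈ S := Or.inl (Or.inr rfl)
  have hHS : ∀ h ∈ H, h ∈ S := fun h hh =>
    Or.inr ⟨Relation.ReflTransGen.single (hC'v h hh).1,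
      Relation.ReflTransGen.single (hC'v h hh).2.1⟩
  have hD := hhold (G.induce S) (G.induce_mem_dagClass hG S)
  have hXY : (⟨X, hXS⟩ : S) ≠ ⟨Y, hYS⟩ := fun h => hdel.1.ne (congrArg Subtype.val h)
  have hnadj : ¬ (G.induce S).toPDGraph.skeleton.Adj ⟨X, hXS⟩ ⟨Y, hYS⟩ := by
    intro h
    have h' : G.toPDGraph.skeleton.Adj X Y := h
    rw [hG'.1] at h'
    exact not_deleteTransform_adj h'
  let Q' : Finset S := Q.subtype (· ∈ S)
  have hmem : ∀ z ∈ Q', (z : V) ∈ Q := fun z hz => Finset.mem_subtype.1 hz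
  have hcard : Q'.card = Q.card := by
    rw [← Finset.card_map (Function.Embedding.subtype (· ∈ S)),
      Finset.subtype_map_of_mem fun x hx => hHS x (hQH hx)]
  have hchild : ∀ z ∈ Q', (G.induce S).edge ⟨X, hXS⟩ z ∧ (G.induce S).edge ⟨Y, hYS⟩ z := fun z hz =>
    ⟨(hGv z (hQH (hmem z hz))).1, (hGv z (hQH (hmem z hz))).2.1⟩
  have hclique : (G.induce S).toPDGraph.skeleton.IsClique (Q' : Set S) := by
    intro a ha b hb hab
    have h₁ := hchild a ha
    have h₂ := hchild b hb
    have haX : (a : V) ≠ X := fun e => DAG.not_edge_self (G := G) (a := X) (by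
      have : G.edge X a := h₁.1
      rwa [e] at this)
    have haY : (a : V) ≠ Y := fun e => DAG.not_edge_self (G := G) (a := Y) (by
      have : G.edge Y a := h₁.2
      rwa [e] at this)
    have h : G.toPDGraph.skeleton.Adj a b := by
      rw [hG'.1]
      exact deleteTransform_adj_of_ne
        (hQ (hmem a ha) (hmem b hb) fun e => hab (Subtype.ext e))
        (fun e => haX e.1) (fun e => haY e.1)
    exact h
  rw [← hcard]
  rcases hPi with rfl | rfl | rfl
  · exact DAG.card_le_of_maxParents hD hXY hchild hclique
  · exact hD Q' hclique
  · exact hD _ _ hXY hnadj Q' hchild hclique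

/-- A delete operator whose set `H` contains no clique with more than `s` nodes is generated, from
any maximal clique of `NA_{Y,X}` that contains `NA_{Y,X} \ H`. -/
theorem mem_selectiveGenerateOps {X Y : V} {H : Finset V} {s : ℕ}
    (hop : C.IsDeleteOperator X Y H)
    (hcard : ∀ Q ⊆ H, C.skeleton.IsClique (Q : Set V) → Q.card ≤ s) :
    H ∈ C.selectiveGenerateOps X Y s := by
  classical
  obtain ⟨-, hH, hcl⟩ := hop
  set N := C.neighborsAdj Y X with hN
  obtain ⟨K, hK, hmax⟩ := Set.Finite.exists_le_maximal
    (s := {K : Finset V | K ⊆ N ∧ C.skeleton.IsClique (K : Set V)}) (Set.toFinite _)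
    (a := N \ H) ⟨Finset.sdiff_subset, by rwa [Finset.coe_sdiff]⟩
  have hNK : N \ K ⊆ H := fun x hx => by
    rw [Finset.mem_sdiff] at hx
    by_contra hxH
    exact hx.2 (hK (Finset.mem_sdiff.2 ⟨hx.1, hxH⟩))
  simp only [selectiveGenerateOps, Finset.mem_biUnion, Finset.mem_image, Finset.mem_filter,
    Finset.mem_powerset, filterCliques, maximalCliques, Finset.mem_univ, true_and]
  refine ⟨K, ⟨hmax, fun Q hQ => hcard Q (hQ.trans hNK)⟩, H ∩ K,
    ⟨Finset.inter_subset_right, hcard _ Finset.inter_subset_left ?_⟩, ?_⟩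
  · exact hmax.prop.2.subset (by simp)
  · ext x
    have h₁ : x ∈ H → x ∈ N := fun h => hH h
    have h₂ : x ∈ N \ K → x ∈ H := fun h => hNK h
    simp only [Finset.mem_union, Finset.mem_inter, Finset.mem_sdiff] at h₂ ⊢
    tauto

end PDGraph

theorem mainTheorem4 {V : Type u} [Fintype V] (C : PDGraph V) (hC : C.IsCPDAG) (s : ℕ)
    (Pi : DAGProperty.{u})
    (hPi : Pi = maxParentsProperty (s + 1) ∨ Pi = maxCliqueProperty s ∨ Pi = vWidthProperty s) :
    C.consistentOperators Pi ⊆ C.generatedOperators s := by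
  rintro ⟨X, Y, H⟩ hop
  exact ⟨hop.1.1, PDGraph.mem_selectiveGenerateOps hop.1 fun _ hQH hQ =>
    PDGraph.card_le_of_isConsistentDelete hC hPi hop hQH hQ⟩
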